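/- Let $d\ge 1$ and let $X_1$ be a random vector in $\mathbb Z^d$ whose law $p(u)=\mathbb P(X_1=u)$ has finite support. Let $U_0=(U_{0,v})_{v\in\mathbb Z^d}$ be a probability distribution on $\mathbb Z^d$ with finite support. Consider the urn with color set $\mathbb Z^d$ and configurations $U_n=(U_{n,v})_{v\in\mathbb Z^d}$, $n\ge 0$, started from $U_0$, in which the $(n+1)$-th selected color $Z_n$ satisfies $$\mathbb P(Z_n=v\mid U_n,\dots,U_0)=\frac{U_{n,v}}{\sum_{u}U_{n,u}}=\frac{U_{n,v}}{n+1},\qquad v\in\mathbb Z^d,$$ and, given the selected color, $U_{n+1,u}=U_{n,u}+p(u-Z_n)$ for all $u\in\mathbb Z^d$. For $\lambda,x\in\mathbb R^d$ let $e(\lambda)=\mathbb E[e^{\langle\lambda,X_1\rangle}]$ and let $$I(x)=\sup_{\lambda\in\mathbb R^d}\{\langle x,\lambda\rangle-e(\lambda)+1\}\in[0,\infty]$$ be the Fenchel–Legendre transform of $e(\cdot)-1$. Then the laws of $Z_n/\log n$, $n\ge2$, satisfy a large deviation principle on $\mathbb R^d$ with speed $\log n$ and rate function $I$: for every $A\subseteq\mathbb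 R^d$, with interior $A^\circ$ and closure $\bar A$, $$-\inf_{x\in A^\circ}I(x)\le\liminf_{n\to\infty}\frac{\log\mathbb P(Z_n/\log n\in A)}{\log n}\le\limsup_{n\to\infty}\frac{\log\mathbb P(Z_n/\log n\in A)}{\log n}\le-\inf_{x\in\bar A}I(x),$$ where $\log 0=-\infty$ and $\inf\emptyset=+\infty$. Moreover $I$ is convex, and it is a good rate function: it is lower semicontinuous with values in $[0,\infty]$, and $\{x: I(x)\le\alpha\}$ is compact for every real $\alpha$. -/

import Mathlib

open MeasureTheory Filter Topology

noncomputable section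

/-- The inclusion of the lattice of colors `ℤ^d` in Euclidean space `ℝ^d`. -/
def colorVec {d : ℕ} (v : Fin d → ℤ) : EuclideanSpace ℝ (Fin d) :=
  WithLp.toLp 2 (fun i => (v i : ℝ))

/-- The urn configurations `U_0, U_1, …` along a sequence `Z_0, Z_1, …` of selected colors:
`U_{n+1} = U_n + R_{Z_n}`, where row `v` of the replacement matrix `R` is the law of `v + X_1`, and
`p` is the law of the increment `X_1`. -/
def urnConfig {d : ℕ} {Ω : Type*} (p U₀ : PMF (Fin d → ℤ)) (Z : ℕ → Ω → Fin d → ℤ) :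
    ℕ → Ω → (Fin d → ℤ) → ℝ
  | 0 => fun _ u => (U₀ u).toReal
  | n + 1 => fun ω u => urnConfig p U₀ Z n ω u + (p (u - Z n ω)).toReal

/-- The σ-algebra generated by the configurations `U_0, …, U_n`. -/
abbrev urnSigma {d : ℕ} {Ω : Type*} (p U₀ : PMF (Fin d → ℤ)) (Z : ℕ → Ω → Fin d → ℤ) (n : ℕ) :
    MeasurableSpace Ω :=
  ⨆ k ≤ n, MeasurableSpace.comap (urnConfig p U₀ Z k) inferInstance

/-- `Z n` is the `(n+1)`-th selected color of the infinite color urn model with increment law `p`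
and initial configuration `U₀`: given `U_0, …, U_n`, it is the color `v` with conditional
probability proportional to `U_{n,v}`. -/
structure IsUrnColorProcess {d : ℕ} {Ω : Type*} [MeasurableSpace Ω] (P : Measure Ω)
    (p U₀ : PMF (Fin d → ℤ)) (Z : ℕ → Ω → Fin d → ℤ) : Prop where
  measurable_color : ∀ n, Measurable (Z n)
  cond_color : ∀ (n : ℕ) (v : Fin d → ℤ),
    P[({ω | Z n ω = v}.indicator fun _ => (1 : ℝ)) | urnSigma p U₀ Z n]
      =ᵐ[P] fun ω => urnConfig p U₀ Z n ω v / ∑' u, urnConfig p U₀ Z n ω u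

/-- `e(l) = E[exp ⟨l, X_1⟩]`, where `X_1` has law `p`. -/
def incrementMGF {d : ℕ} (p : PMF (Fin d → ℤ)) (l : EuclideanSpace ℝ (Fin d)) : ℝ :=
  ∫ v, Real.exp (inner ℝ l (colorVec v)) ∂p.toMeasure

/-- The Fenchel–Legendre transform of a function `f` on `ℝ^d`, with values in `[-∞, ∞]`. -/
def fenchelLegendre {d : ℕ} (f : EuclideanSpace ℝ (Fin d) → ℝ) (x : EuclideanSpace ℝ (Fin d)) :
    EReal :=
  ⨆ l : EuclideanSpace ℝ (Fin d), ((inner ℝ x l - f l : ℝ) : EReal)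

/-- The Fenchel–Legendre transform of `e - 1`. -/
def urnRate {d : ℕ} (p : PMF (Fin d → ℤ)) : EuclideanSpace ℝ (Fin d) → EReal :=
  fenchelLegendre fun l => incrementMGF p l - 1

/-- Convexity of an extended real valued function: its epigraph is convex. -/
def IsConvexEReal {E : Type*} [AddCommGroup E] [Module ℝ E] (I : E → EReal) : Prop :=
  Convex ℝ {q : E × ℝ | I q.1 ≤ (q.2 : EReal)}

/-- A rate function is lower semicontinuous with values in `[0, ∞]`. -/
structure IsRateFunction {E : Type*} [TopologicalSpace E] (I : E → EReal) : Prop where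
  nonneg : ∀ x, 0 ≤ I x
  lsc : LowerSemicontinuous I

/-- A good rate function is a rate function whose level sets are compact. -/
structure IsGoodRateFunction {E : Type*} [TopologicalSpace E] (I : E → EReal) : Prop
    extends IsRateFunction I where
  compact_level : ∀ α : ℝ, IsCompact {x | I x ≤ (α : EReal)}

/-- `log P(Z_n / log n ∈ A) / log n`, with `log 0 = -∞` (only `n ≥ 2` is meaningful). -/
def scaledLogProb {d : ℕ} {Ω : Type*} [MeasurableSpace Ω] (P : Measure Ω)
    (Z : ℕ → Ω → Fin d → ℤ) (A : Set (EuclideanSpace ℝ (Fin d))) (n : ℕ) : EReal :=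
  ENNReal.log (P {ω | (Real.log n)⁻¹ • colorVec (Z n ω) ∈ A}) / (Real.log n : EReal)

end

/-! The total mass of `U_n` is deterministic, equal to `n + 1`, so the law of `Z_n` is `E[U_n] / (n
+ 1)`. One draw adds to `E[U_n]` the convolution of the law of `Z_n` with `p`. Exponential weights
turn the convolution into a product: `E ∑ U_{n,u} e^⟨l,u⟩` is multiplied by `1 + e(l)/(n+1)` at each
step (`tsum_expectedConfig_succ`). Hence the moment generating function of `Z_n` is an explicit
Euler product, and by Gauss's limit for `Γ` it is asymptotic to a positive constant times `n ^ (e(l)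
- 1)` (`tendsto_integral_exp_inner_color`).

What remains is the Gärtner–Ellis theorem at speed `log n` for `L = e - 1`, which is finite and
differentiable everywhere. Upper bound: Markov's inequality on half-spaces, finitely many of which
cover a closed set on which the transform exceeds `a` (`exists_finset_halfspace_cover`). Lower
bound: tilting by `l` concentrates `Z_n / log n` at `∇L(l)` (`eventually_le_measure_of_exposed`),
and every point of finite rate is approximated by such gradients without exceeding a given bound on
its rate (`exists_exposed_near`). The latter uses `L 0 = 0` and `L ≥ -1`. -/

/-- The exponential weight `exp ⟨l, v⟩` of a color `v`. -/
noncomputable def expWeight {d : ℕ} (l : EuclideanSpace ℝ (Fin d)) (v : Fin d → ℤ) : ENNReal :=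
  ENNReal.ofReal (Real.exp (inner ℝ l (colorVec v)))

lemma colorVec_add {d : ℕ} (u v : Fin d → ℤ) : colorVec (u + v) = colorVec u + colorVec v := by
  ext i; simp [colorVec]

lemma expWeight_add {d : ℕ} (l : EuclideanSpace ℝ (Fin d)) (u v : Fin d → ℤ) :
    expWeight l (u + v) = expWeight l u * expWeight l v := by
  simp only [expWeight]
  rw [colorVec_add, inner_add_right, Real.exp_add, ENNReal.ofReal_mul (Real.exp_pos _).le]

/-! ### Moment generating functions of finitely supported laws -/

section mgf

variable {d : ℕ} {q : PMF (Fin d → ℤ)}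

lemma incrementMGF_eq_sum (hq : q.support.Finite) (l : EuclideanSpace ℝ (Fin d)) :
    incrementMGF q l
      = ∑ v ∈ hq.toFinset, (q v).toReal * Real.exp (inner ℝ l (colorVec v)) := by
  have hr : q.toMeasure.restrict q.support = q.toMeasure := q.restrict_toMeasure_support
  have hs : q.toMeasure.restrict (hq.toFinset : Set (Fin d → ℤ)) = q.toMeasure := by
    rw [hq.coe_toFinset, hr]
  rw [incrementMGF, ← hs, setIntegral_finset]
  · refine Finset.sum_congr rfl fun v _ => ?_
    rw [measureReal_def, PMF.toMeasure_apply_singleton _ _ (measurableSet_singleton v), smul_eq_mul]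
  · exact IntegrableOn.finset

lemma incrementMGF_pos (hq : q.support.Finite) (l : EuclideanSpace ℝ (Fin d)) :
    0 < incrementMGF q l := by
  rw [incrementMGF_eq_sum hq]
  refine Finset.sum_pos (fun v hv => mul_pos ?_ (Real.exp_pos _)) ?_
  · exact ENNReal.toReal_pos ((PMF.mem_support_iff _ _).1 (hq.mem_toFinset.1 hv))
      (q.apply_ne_top v)
  · exact hq.toFinset_nonempty.2 q.support_nonempty

lemma incrementMGF_zero (q : PMF (Fin d → ℤ)) : incrementMGF q 0 = 1 := by
  simp [incrementMGF]

lemma ofReal_incrementMGF (hq : q.support.Finite) (l : EuclideanSpace ℝ (Fin d)) :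
    ENNReal.ofReal (incrementMGF q l) = ∑' v, q v * expWeight l v := by
  rw [incrementMGF_eq_sum hq, tsum_eq_sum (s := hq.toFinset),
    ENNReal.ofReal_sum_of_nonneg fun v _ => by positivity]
  · refine Finset.sum_congr rfl fun v _ => ?_
    rw [ENNReal.ofReal_mul ENNReal.toReal_nonneg, ENNReal.ofReal_toReal (q.apply_ne_top v),
      expWeight]
  · intro v hv
    have : q v = 0 := by simpa [PMF.mem_support_iff] using hv
    simp [this]

lemma differentiable_incrementMGF (hq : q.support.Finite) :
    Differentiable ℝ (incrementMGF q) := by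
  have : incrementMGF q = fun l => ∑ v ∈ hq.toFinset,
      (q v).toReal * Real.exp (inner ℝ l (colorVec v)) := funext (incrementMGF_eq_sum hq)
  rw [this]
  exact Differentiable.fun_sum fun v _ => ((differentiable_id.inner ℝ
    (differentiable_const (colorVec v))).exp).const_mul _

end mgf

/-! ### The exact moment generating function of the selected color -/

section urn

variable {d : ℕ} {Ω : Type*} {p U₀ : PMF (Fin d → ℤ)} {Z : ℕ → Ω → Fin d → ℤ}

lemma urnConfig_nonneg (n : ℕ) (ω : Ω) (u : Fin d → ℤ) : 0 ≤ urnConfig p U₀ Z n ω u := by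
  induction n with
  | zero => exact ENNReal.toReal_nonneg
  | succ n ih => exact add_nonneg ih ENNReal.toReal_nonneg

lemma PMF.hasSum_toReal {α : Type*} (q : PMF α) : HasSum (fun u => (q u).toReal) 1 := by
  have h := ENNReal.hasSum_toReal (f := q) (by simp [q.tsum_coe])
  rwa [← ENNReal.tsum_toReal_eq q.apply_ne_top, q.tsum_coe, ENNReal.toReal_one] at h

lemma hasSum_urnConfig (n : ℕ) (ω : Ω) : HasSum (urnConfig p U₀ Z n ω) (n + 1) := by
  induction n with
  | zero => simpa [urnConfig] using PMF.hasSum_toReal U₀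
  | succ n ih =>
    push_cast
    have h : HasSum (fun u => (p (u - Z n ω)).toReal) 1 :=
      ((Equiv.subRight (Z n ω)).hasSum_iff (f := fun w => (p w).toReal)).2 (PMF.hasSum_toReal p)
    exact ih.add h

lemma urnConfig_le (n : ℕ) (ω : Ω) (u : Fin d → ℤ) : urnConfig p U₀ Z n ω u ≤ n + 1 :=
  le_hasSum (hasSum_urnConfig n ω) u fun v _ => urnConfig_nonneg n ω v

variable [MeasurableSpace Ω] {P : Measure Ω}

lemma measurable_urnConfig (hZ : ∀ n, Measurable (Z n)) (n : ℕ) :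
    Measurable (urnConfig p U₀ Z n) := by
  induction n with
  | zero => exact measurable_const
  | succ n ih =>
    refine measurable_pi_iff.2 fun u => ((measurable_pi_apply u).comp ih).add ?_
    exact (Measurable.of_discrete (f := fun z => (p (u - z)).toReal)).comp (hZ n)

lemma urnSigma_le (hZ : ∀ n, Measurable (Z n)) (n : ℕ) :
    urnSigma p U₀ Z n ≤ ‹MeasurableSpace Ω› :=
  iSup₂_le fun k _ => (measurable_urnConfig hZ k).comap_le

/-- The expected weight of color `u` in the `n`-th configuration. -/
noncomputable def expectedConfig (P : Measure Ω) (p U₀ : PMF (Fin d → ℤ)) (Z : ℕ → Ω → Fin d → ℤ)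
    (n : ℕ) (u : Fin d → ℤ) : ENNReal :=
  ∫⁻ ω, ENNReal.ofReal (urnConfig p U₀ Z n ω u) ∂P

/-- Taking expectations in the conditional law is linear in `U_n` because the normalization `n + 1`
is not random. This is the only use of the conditioning; afterwards only one-dimensional marginals
of the process matter. -/
lemma measure_color_eq [IsProbabilityMeasure P] (hZ : IsUrnColorProcess P p U₀ Z) (n : ℕ)
    (v : Fin d → ℤ) :
    P {ω | Z n ω = v} = expectedConfig P p U₀ Z n v * (n + 1 : ENNReal)⁻¹ := by
  have hm : MeasurableSet {ω | Z n ω = v} := hZ.measurable_color n (measurableSet_singleton v)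
  have hU : Measurable fun ω => urnConfig p U₀ Z n ω v :=
    (measurable_pi_apply v).comp (measurable_urnConfig hZ.measurable_color n)
  have hint : Integrable (fun ω => urnConfig p U₀ Z n ω v) P :=
    Integrable.of_bound hU.aestronglyMeasurable ((n : ℝ) + 1)
      (ae_of_all _ fun ω => by
        rw [Real.norm_of_nonneg (urnConfig_nonneg n ω v)]; exact urnConfig_le n ω v)
  have h1 := integral_condExp (urnSigma_le (p := p) (U₀ := U₀) hZ.measurable_color n) (μ := P)
    (f := {ω | Z n ω = v}.indicator fun _ => (1 : ℝ))
  rw [integral_congr_ae (hZ.cond_color n v)] at h1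
  simp only [(hasSum_urnConfig n _).tsum_eq] at h1
  rw [integral_div, integral_indicator hm, setIntegral_const, smul_eq_mul, mul_one] at h1
  rw [expectedConfig, ← ofReal_integral_eq_lintegral_ofReal hint
    (ae_of_all _ fun ω => urnConfig_nonneg n ω v), ← ENNReal.ofReal_toReal (measure_ne_top P _),
    ← measureReal_def, ← h1, div_eq_mul_inv, ENNReal.ofReal_mul
      (integral_nonneg fun ω => urnConfig_nonneg n ω v), ENNReal.ofReal_inv_of_pos (by positivity),
    ENNReal.ofReal_add (by positivity) zero_le_one]
  simp

lemma lintegral_comp_color (hZ : IsUrnColorProcess P p U₀ Z) (n : ℕ)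
    (f : (Fin d → ℤ) → ENNReal) :
    ∫⁻ ω, f (Z n ω) ∂P = ∑' v, P {ω | Z n ω = v} * f v := by
  rw [← lintegral_map (f := f) Measurable.of_discrete (hZ.measurable_color n), lintegral_countable']
  refine tsum_congr fun v => ?_
  rw [Measure.map_apply (hZ.measurable_color n) (measurableSet_singleton v), mul_comm]
  rfl

lemma expectedConfig_succ [IsProbabilityMeasure P] (hZ : IsUrnColorProcess P p U₀ Z) (n : ℕ)
    (u : Fin d → ℤ) :
    expectedConfig P p U₀ Z (n + 1) u
      = expectedConfig P p U₀ Z n u + ∑' v, P {ω | Z n ω = v} * p (u - v) := by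
  have hU : Measurable fun ω => urnConfig p U₀ Z n ω u :=
    (measurable_pi_apply u).comp (measurable_urnConfig hZ.measurable_color n)
  rw [← lintegral_comp_color hZ n fun v => p (u - v), expectedConfig, expectedConfig,
    ← lintegral_add_left hU.ennreal_ofReal]
  refine lintegral_congr fun ω => ?_
  rw [urnConfig, ENNReal.ofReal_add (urnConfig_nonneg n ω u) ENNReal.toReal_nonneg,
    ENNReal.ofReal_toReal (p.apply_ne_top _)]

lemma lintegral_expWeight_color [IsProbabilityMeasure P] (hZ : IsUrnColorProcess P p U₀ Z) (n : ℕ)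
    (l : EuclideanSpace ℝ (Fin d)) :
    ∫⁻ ω, expWeight l (Z n ω) ∂P
      = (∑' u, expectedConfig P p U₀ Z n u * expWeight l u) * (n + 1 : ENNReal)⁻¹ := by
  rw [lintegral_comp_color hZ, ← ENNReal.tsum_mul_right]
  refine tsum_congr fun v => ?_
  rw [measure_color_eq hZ]
  ring

/-- The added row contributes the transform of a convolution, which factors. In `ENNReal` the sums
may be exchanged without any summability argument. -/
lemma tsum_expectedConfig_succ [IsProbabilityMeasure P] (hZ : IsUrnColorProcess P p U₀ Z) (n : ℕ)
    (l : EuclideanSpace ℝ (Fin d)) :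
    ∑' u, expectedConfig P p U₀ Z (n + 1) u * expWeight l u
      = (∑' u, expectedConfig P p U₀ Z n u * expWeight l u)
        * (1 + (∑' v, p v * expWeight l v) * (n + 1 : ENNReal)⁻¹) := by
  have key : ∑' u, (∑' v, P {ω | Z n ω = v} * p (u - v)) * expWeight l u
      = (∫⁻ ω, expWeight l (Z n ω) ∂P) * ∑' v, p v * expWeight l v := by
    rw [lintegral_comp_color hZ]
    simp_rw [← ENNReal.tsum_mul_right]
    rw [ENNReal.tsum_comm]
    refine tsum_congr fun v => ?_
    rw [← ENNReal.tsum_mul_left, ← (Equiv.addRight v).tsum_eq]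
    refine tsum_congr fun u => ?_
    simp only [Equiv.coe_addRight, add_sub_cancel_right, expWeight_add]
    ring
  simp_rw [expectedConfig_succ hZ, add_mul]
  rw [ENNReal.tsum_add, key, lintegral_expWeight_color hZ]
  ring

/-- The explicit moment generating function of the selected color. -/
lemma lintegral_expWeight_color_eq [IsProbabilityMeasure P] (hp : p.support.Finite)
    (hU₀ : U₀.support.Finite)
    (hZ : IsUrnColorProcess P p U₀ Z) (n : ℕ) (l : EuclideanSpace ℝ (Fin d)) :
    ∫⁻ ω, expWeight l (Z n ω) ∂P = ENNReal.ofReal (incrementMGF U₀ l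
      * (∏ k ∈ Finset.range n, (1 + incrementMGF p l / (k + 1))) / (n + 1)) := by
  have hpos := incrementMGF_pos hp l
  have hpos₀ := incrementMGF_pos hU₀ l
  have hG : ∑' u, expectedConfig P p U₀ Z n u * expWeight l u = ENNReal.ofReal (incrementMGF U₀ l
      * (∏ k ∈ Finset.range n, (1 + incrementMGF p l / (k + 1)))) := by
    induction n with
    | zero =>
      simp [expectedConfig, urnConfig, ofReal_incrementMGF hU₀,
        ENNReal.ofReal_toReal (U₀.apply_ne_top _)]
    | succ n ih =>
      rw [tsum_expectedConfig_succ hZ, ih, Finset.prod_range_succ, ← mul_assoc,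
        ENNReal.ofReal_mul (p := _ * _) (by positivity), ← ofReal_incrementMGF hp,
        ENNReal.ofReal_add zero_le_one (by positivity), ENNReal.ofReal_one,
        ENNReal.ofReal_div_of_pos (by positivity), ENNReal.ofReal_add (by positivity) zero_le_one]
      simp [div_eq_mul_inv]
  rw [lintegral_expWeight_color hZ, hG, ENNReal.ofReal_div_of_pos (by positivity),
    ENNReal.ofReal_add (by positivity) zero_le_one]
  simp [div_eq_mul_inv]

lemma integrable_exp_inner_color [IsProbabilityMeasure P] (hp : p.support.Finite)
    (hU₀ : U₀.support.Finite)
    (hZ : IsUrnColorProcess P p U₀ Z) (n : ℕ) (l : EuclideanSpace ℝ (Fin d)) :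
    Integrable (fun ω => Real.exp (inner ℝ l (colorVec (Z n ω)))) P := by
  refine ⟨((Measurable.of_discrete (f := fun z => Real.exp (inner ℝ l (colorVec z)))).comp
    (hZ.measurable_color n)).aestronglyMeasurable, ?_⟩
  rw [hasFiniteIntegral_iff_ofReal (ae_of_all _ fun ω => (Real.exp_pos _).le)]
  have := lintegral_expWeight_color_eq hp hU₀ hZ n l
  simp only [expWeight] at this
  rw [this]
  exact ENNReal.ofReal_lt_top

lemma integral_exp_inner_color [IsProbabilityMeasure P] (hp : p.support.Finite)
    (hU₀ : U₀.support.Finite)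
    (hZ : IsUrnColorProcess P p U₀ Z) (n : ℕ) (l : EuclideanSpace ℝ (Fin d)) :
    ∫ ω, Real.exp (inner ℝ l (colorVec (Z n ω))) ∂P = incrementMGF U₀ l
      * (∏ k ∈ Finset.range n, (1 + incrementMGF p l / (k + 1))) / (n + 1) := by
  have hpos := incrementMGF_pos hp l
  have hpos₀ := incrementMGF_pos hU₀ l
  rw [integral_eq_lintegral_of_nonneg_ae (ae_of_all _ fun ω => (Real.exp_pos _).le)
    (integrable_exp_inner_color hp hU₀ hZ n l).aestronglyMeasurable]
  have := lintegral_expWeight_color_eq hp hU₀ hZ n l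
  simp only [expWeight] at this
  rw [this, ENNReal.toReal_ofReal (by positivity)]

end urn

/-! ### Power asymptotics of the moment generating function -/

/-- Euler's product: `∏_{k=1}^n (1 + a/k)` grows like `n ^ a / Γ(a + 1)`. -/
lemma tendsto_prod_one_add_div {a : ℝ} (ha : 0 < a) :
    Tendsto (fun n : ℕ => (∏ k ∈ Finset.range n, (1 + a / (k + 1))) / (n + 1) * (n : ℝ) ^ (1 - a))
      atTop (𝓝 (a * Real.Gamma a)⁻¹) := by
  have h1 : Tendsto (fun n : ℕ => (n : ℝ) / (n + 1) * (a * Real.GammaSeq a n)⁻¹) atTop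
      (𝓝 (1 * (a * Real.Gamma a)⁻¹)) :=
    tendsto_natCast_div_add_atTop (1 : ℝ) |>.mul
      (((Real.GammaSeq_tendsto_Gamma a).const_mul a).inv₀
        (mul_pos ha (Real.Gamma_pos_of_pos ha)).ne')
  rw [one_mul] at h1
  refine h1.congr' ?_
  filter_upwards [eventually_gt_atTop 0] with n hn
  have hn' : (0 : ℝ) < n := by exact_mod_cast hn
  -- The factor `j = 0` of the product in `Real.GammaSeq` is `a`; the others, divided by `k + 1`,
  -- are those of Euler's product.
  have h2 : (∏ k ∈ Finset.range n, (1 + a / ((k : ℝ) + 1))) * n.factorial * a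
      = ∏ j ∈ Finset.range (n + 1), (a + j) := by
    rw [Finset.prod_range_succ', ← Finset.prod_range_add_one_eq_factorial]
    push_cast
    rw [← Finset.prod_mul_distrib, add_zero]
    congr 1
    refine Finset.prod_congr rfl fun k _ => ?_
    have : (k : ℝ) + 1 ≠ 0 := by positivity
    field_simp
    ring
  have h3 : 0 < ∏ k ∈ Finset.range n, (1 + a / ((k : ℝ) + 1)) :=
    Finset.prod_pos fun k _ => by positivity
  rw [Real.GammaSeq, ← h2, Real.rpow_sub hn', Real.rpow_one]
  have := Real.rpow_pos_of_pos hn' a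
  field_simp

lemma tendsto_integral_exp_inner_color {d : ℕ} {Ω : Type*} {p U₀ : PMF (Fin d → ℤ)}
    {Z : ℕ → Ω → Fin d → ℤ} [MeasurableSpace Ω] {P : Measure Ω} [IsProbabilityMeasure P]
    (hp : p.support.Finite) (hU₀ : U₀.support.Finite)
    (hZ : IsUrnColorProcess P p U₀ Z) (l : EuclideanSpace ℝ (Fin d)) :
    ∃ c : ℝ, 0 < c ∧ Tendsto (fun n : ℕ => (∫ ω, Real.exp (inner ℝ l (colorVec (Z n ω))) ∂P)
      * (n : ℝ) ^ (-(incrementMGF p l - 1))) atTop (𝓝 c) := by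
  have hpos := incrementMGF_pos hp l
  refine ⟨incrementMGF U₀ l * (incrementMGF p l * Real.Gamma (incrementMGF p l))⁻¹,
    mul_pos (incrementMGF_pos hU₀ l) (inv_pos.2 (mul_pos hpos (Real.Gamma_pos_of_pos hpos))), ?_⟩
  refine ((tendsto_prod_one_add_div hpos).const_mul _).congr fun n => ?_
  rw [integral_exp_inner_color hp hU₀ hZ, neg_sub]
  ring

/-! ### Fenchel–Legendre transforms and exposed points -/

section convex

variable {d : ℕ} {L : EuclideanSpace ℝ (Fin d) → ℝ}

lemma continuous_inner_sub (L : EuclideanSpace ℝ (Fin d) → ℝ) (l : EuclideanSpace ℝ (Fin d)) :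
    Continuous fun x : EuclideanSpace ℝ (Fin d) => inner ℝ x l - L l := by
  fun_prop

lemma fenchelLegendre_le_coe_iff {x : EuclideanSpace ℝ (Fin d)} {b : ℝ} :
    fenchelLegendre L x ≤ (b : EReal) ↔ ∀ l, inner ℝ x l - L l ≤ b := by
  simp only [fenchelLegendre, iSup_le_iff, EReal.coe_le_coe_iff]

lemma coe_lt_fenchelLegendre_iff {x : EuclideanSpace ℝ (Fin d)} {a : ℝ} :
    (a : EReal) < fenchelLegendre L x ↔ ∃ l, a < inner ℝ x l - L l := by
  simp only [fenchelLegendre, lt_iSup_iff, EReal.coe_lt_coe_iff]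

/-- The transform is a supremum of functions affine in `x`, so nothing is required of `L`. -/
lemma isConvexEReal_fenchelLegendre (L : EuclideanSpace ℝ (Fin d) → ℝ) :
    IsConvexEReal (fenchelLegendre L) := by
  rintro ⟨x, a⟩ hx ⟨y, b⟩ hy s t hs ht hst
  simp only [Set.mem_ofPred_eq, Prod.smul_mk, Prod.mk_add_mk,
    fenchelLegendre_le_coe_iff, smul_eq_mul] at hx hy ⊢
  intro l
  rw [inner_add_left, inner_smul_left, inner_smul_left]
  have h1 := mul_le_mul_of_nonneg_left (hx l) hs
  have h2 := mul_le_mul_of_nonneg_left (hy l) ht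
  have h3 : L l = s * L l + t * L l := by rw [← add_mul, hst, one_mul]
  simp only [conj_trivial]
  linarith

lemma lowerSemicontinuous_fenchelLegendre (L : EuclideanSpace ℝ (Fin d) → ℝ) :
    LowerSemicontinuous (fenchelLegendre L) := by
  have : fenchelLegendre L = fun x => ⨆ l : EuclideanSpace ℝ (Fin d),
      ((inner ℝ x l - L l : ℝ) : EReal) := rfl
  rw [this]
  exact lowerSemicontinuous_iSup fun l =>
    (continuous_coe_real_ereal.comp (continuous_inner_sub L l)).lowerSemicontinuous

lemma fenchelLegendre_nonneg (h0 : L 0 = 0) (x : EuclideanSpace ℝ (Fin d)) :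
    0 ≤ fenchelLegendre L x := by
  have := le_iSup (fun l : EuclideanSpace ℝ (Fin d) => ((inner ℝ x l - L l : ℝ) : EReal)) 0
  simpa [fenchelLegendre, h0] using this

/-- The coordinate directions and their opposites. -/
noncomputable def signedBasis (d : ℕ) : Finset (EuclideanSpace ℝ (Fin d)) := by
  classical
  exact Finset.univ.image (fun i => EuclideanSpace.single i (1 : ℝ)) ∪
    Finset.univ.image (fun i => -EuclideanSpace.single i (1 : ℝ))

lemma single_mem_signedBasis (i : Fin d) : EuclideanSpace.single i (1 : ℝ) ∈ signedBasis d := by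
  classical
  exact Finset.mem_union_left _ (Finset.mem_image_of_mem _ (Finset.mem_univ i))

lemma neg_single_mem_signedBasis (i : Fin d) :
    -EuclideanSpace.single i (1 : ℝ) ∈ signedBasis d := by
  classical
  exact Finset.mem_union_right _ (Finset.mem_image_of_mem
    (fun i => -EuclideanSpace.single i (1 : ℝ)) (Finset.mem_univ i))

/-- The `2d` inequalities bound each coordinate from both sides. This box replaces exponential
tightness: its complement is already a finite union of half-spaces of the required form. -/
lemma isCompact_setOf_signedBasis (L : EuclideanSpace ℝ (Fin d) → ℝ) (a : ℝ) :
    IsCompact {x : EuclideanSpace ℝ (Fin d) | ∀ l ∈ signedBasis d, inner ℝ x l - L l ≤ a} := by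
  have hK : IsCompact ((EuclideanSpace.equiv (Fin d) ℝ).toHomeomorph ⁻¹'
      (Set.univ.pi fun i => Set.Icc (-(a + L (-EuclideanSpace.single i (1 : ℝ))))
        (a + L (EuclideanSpace.single i (1 : ℝ))))) :=
    (Homeomorph.isCompact_preimage _).2 (isCompact_univ_pi fun i => isCompact_Icc)
  refine hK.of_isClosed_subset ?_ ?_
  · have : {x : EuclideanSpace ℝ (Fin d) | ∀ l ∈ signedBasis d, inner ℝ x l - L l ≤ a}
        = ⋂ l ∈ signedBasis d, {x | inner ℝ x l - L l ≤ a} := by ext; simp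
    rw [this]
    exact isClosed_biInter fun l _ => isClosed_le (continuous_inner_sub L l) continuous_const
  · intro x hx i _
    have h1 := hx _ (single_mem_signedBasis i)
    have h2 := hx _ (neg_single_mem_signedBasis i)
    simp only [inner_neg_right, EuclideanSpace.inner_single_right, one_mul, conj_trivial] at h1 h2
    change -(a + L (-EuclideanSpace.single i (1 : ℝ))) ≤ x i ∧
      x i ≤ a + L (EuclideanSpace.single i (1 : ℝ))
    constructor <;> linarith

lemma isCompact_fenchelLegendre_le (L : EuclideanSpace ℝ (Fin d) → ℝ) (a : ℝ) :
    IsCompact {x | fenchelLegendre L x ≤ (a : EReal)} := by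
  refine (isCompact_setOf_signedBasis L a).of_isClosed_subset
    ((lowerSemicontinuous_fenchelLegendre L).isClosed_preimage _) fun x hx l _ => ?_
  exact fenchelLegendre_le_coe_iff.1 hx l

lemma isGoodRateFunction_fenchelLegendre (h0 : L 0 = 0) :
    IsGoodRateFunction (fenchelLegendre L) where
  nonneg := fenchelLegendre_nonneg h0
  lsc := lowerSemicontinuous_fenchelLegendre L
  compact_level := isCompact_fenchelLegendre_le L

/-- A closed set on which a Fenchel–Legendre transform exceeds `a` is covered by finitely many of
the half-spaces that define the transform. -/
lemma exists_finset_halfspace_cover {F : Set (EuclideanSpace ℝ (Fin d))} (hF : IsClosed F) {a : ℝ}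
    (h : ∀ x ∈ F, (a : EReal) < fenchelLegendre L x) :
    ∃ T : Finset (EuclideanSpace ℝ (Fin d)), ∀ x ∈ F, ∃ l ∈ T, a < inner ℝ x l - L l := by
  classical
  obtain ⟨T, hT⟩ := ((isCompact_setOf_signedBasis L a).inter_left hF).elim_finite_subcover
    (fun l => {x | a < inner ℝ x l - L l})
    (fun l => isOpen_lt continuous_const (continuous_inner_sub L l))
    (fun x hx => Set.mem_iUnion.2 (coe_lt_fenchelLegendre_iff.1 (h x hx.1)))
  refine ⟨T ∪ signedBasis d, fun x hx => ?_⟩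
  by_cases hK : ∀ l ∈ signedBasis d, inner ℝ x l - L l ≤ a
  · obtain ⟨l, hl, hxl⟩ := Set.mem_iUnion₂.1 (hT ⟨hx, hK⟩)
    exact ⟨l, Finset.mem_union_left _ hl, hxl⟩
  · push Not at hK
    obtain ⟨l, hl, hxl⟩ := hK
    exact ⟨l, Finset.mem_union_right _ hl, hxl⟩

/-- Leaving `U` then forces one of finitely many linear inequalities, each of which a single
exponential moment controls. -/
lemma exists_signedBasis_subset {U : Set (EuclideanSpace ℝ (Fin d))} (hU : IsOpen U)
    {y : EuclideanSpace ℝ (Fin d)} (hy : y ∈ U) :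
    ∃ δ > 0, ∀ z, (∀ h ∈ signedBasis d, inner ℝ z h ≤ inner ℝ y h + δ) → z ∈ U := by
  have hV : IsOpen ((EuclideanSpace.equiv (Fin d) ℝ).symm ⁻¹' U) :=
    hU.preimage (EuclideanSpace.equiv (Fin d) ℝ).symm.continuous
  obtain ⟨ε, hε, hball⟩ := Metric.isOpen_iff.1 hV (EuclideanSpace.equiv (Fin d) ℝ y) (by simpa)
  refine ⟨ε / 2, half_pos hε, fun z hz => ?_⟩
  have hmem : EuclideanSpace.equiv (Fin d) ℝ z ∈
      Metric.ball (EuclideanSpace.equiv (Fin d) ℝ y) ε := by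
    rw [Metric.mem_ball, dist_pi_lt_iff hε]
    intro i
    have h1 := hz _ (single_mem_signedBasis i)
    have h2 := hz _ (neg_single_mem_signedBasis i)
    simp only [inner_neg_right, EuclideanSpace.inner_single_right, one_mul, conj_trivial] at h1 h2
    change dist (z i) (y i) < ε
    rw [Real.dist_eq, abs_lt]
    constructor <;> linarith
  simpa using hball hmem

/-- A point where the Fenchel–Legendre transform is at most `b` is a limit of exposed points where
it is at most `b`, obtained by maximizing `⟨x, l⟩ - L l - ε ‖l‖² / 2`. -/
lemma exists_exposed_near (hL : Differentiable ℝ L) (h0 : L 0 = 0) (hlow : ∀ l, -1 ≤ L l)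
    {x : EuclideanSpace ℝ (Fin d)} {b : ℝ} (hb : ∀ l, inner ℝ x l - L l ≤ b)
    {G : Set (EuclideanSpace ℝ (Fin d))} (hG : IsOpen G) (hx : x ∈ G) :
    ∃ y ∈ G, ∃ l, inner ℝ y l - L l ≤ b ∧
      ∀ h, HasDerivAt (fun t : ℝ => L (l + t • h)) (inner ℝ y h) 0 := by
  obtain ⟨r, hr, hball⟩ := Metric.isOpen_iff.1 hG x hx
  have hb0 : 0 ≤ b := by simpa [h0] using hb 0
  -- Chosen so that `2 ε b = r² b / (b + 1) < r²`, which will keep `x - ε • l` within distance `r`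
  -- of `x`.
  set ε : ℝ := r ^ 2 / (2 * (b + 1)) with hε
  have hεpos : 0 < ε := by positivity
  have hεb : 2 * ε * b < r ^ 2 := by
    rw [hε]
    have : 2 * (r ^ 2 / (2 * (b + 1))) * b = r ^ 2 * (b / (b + 1)) := by field_simp
    rw [this]
    have h1 : b / (b + 1) < 1 := by rw [div_lt_one (by positivity)]; linarith
    nlinarith [sq_nonneg r, pow_pos hr 2]
  set φ : EuclideanSpace ℝ (Fin d) → ℝ := fun l => L l + ε / 2 * ‖l‖ ^ 2 - inner ℝ x l with hφ
  have hφc : Continuous φ := by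
    have := hL.continuous
    fun_prop
  -- Coercivity: for large `‖l‖`, `φ l ≥ -1 + (ε/2 ‖l‖ - ‖x‖) ‖l‖ ≥ -1 + ‖l‖ ≥ 0 = φ 0`.
  obtain ⟨l, hl⟩ := hφc.exists_forall_le' 0 <| by
    have hev := (tendsto_norm_cocompact_atTop (E := EuclideanSpace ℝ (Fin d))).eventually_ge_atTop
      (max 1 ((‖x‖ + 1) * (2 / ε)))
    filter_upwards [hev] with l hl
    have h1 : 1 ≤ ‖l‖ := (le_max_left _ _).trans hl
    have h2 : (‖x‖ + 1) * (2 / ε) ≤ ‖l‖ := (le_max_right _ _).trans hl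
    have h3 : ‖x‖ + 1 ≤ ε / 2 * ‖l‖ := by
      have := mul_le_mul_of_nonneg_left h2 (half_pos hεpos).le
      have h4 : ε / 2 * ((‖x‖ + 1) * (2 / ε)) = ‖x‖ + 1 := by field_simp
      linarith
    have h5 := (abs_le.1 (abs_real_inner_le_norm x l)).2
    have h6 := hlow l
    have h7 := mul_le_mul_of_nonneg_right h3 (norm_nonneg l)
    simp only [hφ, h0, norm_zero, inner_zero_right]
    nlinarith
  have hl0 : L l + ε / 2 * ‖l‖ ^ 2 - inner ℝ x l ≤ 0 := by
    have := hl 0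
    simpa [hφ, h0] using this
  -- The critical point equation `∇φ(l) = 0` reads `∇L(l) = x - ε l`. Comparison with `φ 0 = 0`
  -- gives `ε ‖l‖² ≤ 2b`.
  refine ⟨x - ε • l, hball ?_, l, ?_, fun h => ?_⟩
  · rw [Metric.mem_ball, dist_eq_norm, sub_sub_cancel_left, norm_neg, norm_smul,
      Real.norm_of_nonneg hεpos.le]
    refine lt_of_pow_lt_pow_left₀ 2 hr.le ?_
    have h1 := hb l
    have h2 : ε * (ε * ‖l‖ ^ 2) ≤ ε * (2 * b) := mul_le_mul_of_nonneg_left (by linarith) hεpos.le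
    calc (ε * ‖l‖) ^ 2 = ε * (ε * ‖l‖ ^ 2) := by ring
      _ ≤ ε * (2 * b) := h2
      _ < r ^ 2 := by linarith
  · rw [inner_sub_left, inner_smul_left, real_inner_self_eq_norm_sq]
    have h1 := hb l
    have h2 : 0 ≤ ε * ‖l‖ ^ 2 := by positivity
    simp only [conj_trivial]
    linarith
  · have hline : HasDerivAt (fun t : ℝ => l + t • h) h 0 := by
      simpa using ((hasDerivAt_id (0 : ℝ)).smul_const h).const_add l
    have hD : HasDerivAt (fun t : ℝ => L (l + t • h)) (fderiv ℝ L l h) 0 := by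
      have hf : HasFDerivAt L (fderiv ℝ L l) (l + (0 : ℝ) • h) := by
        simpa using (hL l).hasFDerivAt
      exact hf.comp_hasDerivAt 0 hline
    have hφD : HasDerivAt (fun t : ℝ => φ (l + t • h))
        (fderiv ℝ L l h + ε / 2 * (2 * inner ℝ l h) - inner ℝ x h) 0 := by
      have hn : HasDerivAt (fun t : ℝ => ‖l + t • h‖ ^ 2) (2 * inner ℝ l h) 0 := by
        simpa using hline.norm_sq
      have hi : HasDerivAt (fun t : ℝ => (inner ℝ x (l + t • h) : ℝ)) (inner ℝ x h) 0 := by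
        simpa using (hasDerivAt_const (0 : ℝ) x).inner ℝ hline
      exact (hD.add (hn.const_mul (ε / 2))).sub hi
    have hmin : IsLocalMin (fun t : ℝ => φ (l + t • h)) 0 :=
      Eventually.of_forall fun t => by simpa using hl (l + t • h)
    have hzero := hmin.hasDerivAt_eq_zero hφD
    have : (inner ℝ (x - ε • l) h : ℝ) = fderiv ℝ L l h := by
      rw [inner_sub_left, inner_smul_left]
      simp only [conj_trivial]
      linarith
    rwa [this]

end convex

/-! ### From power bounds to logarithmic bounds -/

lemma eventually_mul_rpow_le {a b : ℝ} (C : ℝ) {D : ℝ} (hD : 0 < D) (hab : a < b) :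
    ∀ᶠ n : ℕ in atTop, C * (n : ℝ) ^ a ≤ D * (n : ℝ) ^ b := by
  have h := ((tendsto_rpow_atTop (sub_pos.2 hab)).comp
    tendsto_natCast_atTop_atTop).eventually_ge_atTop (C / D)
  filter_upwards [h, eventually_gt_atTop 0] with n hn hn0
  have hn' : (0 : ℝ) < n := by exact_mod_cast hn0
  simp only [Function.comp_apply, Real.rpow_sub hn'] at hn
  rw [div_le_div_iff₀ hD (Real.rpow_pos_of_pos hn' a)] at hn
  linarith

section scaledLogProb

variable {d : ℕ} {Ω : Type*} [MeasurableSpace Ω] {P : Measure Ω} [IsFiniteMeasure P]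
  {Z : ℕ → Ω → Fin d → ℤ}

lemma coe_le_scaledLogProb {A : Set (EuclideanSpace ℝ (Fin d))} {n : ℕ} (hn : 2 ≤ n) {z : ℝ}
    (h : (n : ℝ) ^ z ≤ P.real {ω | (Real.log n)⁻¹ • colorVec (Z n ω) ∈ A}) :
    (z : EReal) ≤ scaledLogProb P Z A n := by
  have hn1 : (1 : ℝ) < n := by exact_mod_cast hn
  have hlog := Real.log_pos hn1
  have hpos : (0 : ℝ) < (n : ℝ) ^ z := Real.rpow_pos_of_pos (by linarith) z
  rw [scaledLogProb, EReal.le_div_iff_mul_le (by exact_mod_cast hlog) (EReal.coe_ne_top _),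
    ← ENNReal.ofReal_toReal (measure_ne_top P _), ← measureReal_def, ← EReal.coe_mul,
    ← Real.log_rpow (by linarith), ← ENNReal.log_ofReal_of_pos hpos]
  exact ENNReal.log_le_log (ENNReal.ofReal_le_ofReal h)

lemma scaledLogProb_le_coe {A : Set (EuclideanSpace ℝ (Fin d))} {n : ℕ} (hn : 2 ≤ n) {z : ℝ}
    (h : P.real {ω | (Real.log n)⁻¹ • colorVec (Z n ω) ∈ A} ≤ (n : ℝ) ^ z) :
    scaledLogProb P Z A n ≤ (z : EReal) := by
  have hn1 : (1 : ℝ) < n := by exact_mod_cast hn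
  have hlog := Real.log_pos hn1
  have hpos : (0 : ℝ) < (n : ℝ) ^ z := Real.rpow_pos_of_pos (by linarith) z
  rw [scaledLogProb, EReal.div_le_iff_le_mul (by exact_mod_cast hlog) (EReal.coe_ne_top _),
    ← ENNReal.ofReal_toReal (measure_ne_top P _), ← measureReal_def, mul_comm, ← EReal.coe_mul,
    ← Real.log_rpow (by linarith), ← ENNReal.log_ofReal_of_pos hpos]
  exact ENNReal.log_le_log (ENNReal.ofReal_le_ofReal h)

end scaledLogProb

/-! ### The Gärtner–Ellis theorem at speed `log n` -/

section largeDeviations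

variable {d : ℕ} {Ω : Type*} [MeasurableSpace Ω] {P : Measure Ω} [IsProbabilityMeasure P]
  {Y : ℕ → Ω → EuclideanSpace ℝ (Fin d)} {L : EuclideanSpace ℝ (Fin d) → ℝ}

/-- The exponential moments of `Y n` are finite, and they grow like the powers `n ^ L l`. -/
structure HasPowerMGF (P : Measure Ω) (Y : ℕ → Ω → EuclideanSpace ℝ (Fin d))
    (L : EuclideanSpace ℝ (Fin d) → ℝ) : Prop where
  measurable : ∀ n, Measurable (Y n)
  integrable : ∀ n l, Integrable (fun ω => Real.exp (inner ℝ l (Y n ω))) P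
  tendsto : ∀ l, ∃ c : ℝ, 0 < c ∧ Tendsto (fun n : ℕ =>
    (∫ ω, Real.exp (inner ℝ l (Y n ω)) ∂P) * (n : ℝ) ^ (-L l)) atTop (𝓝 c)

namespace HasPowerMGF

omit [IsProbabilityMeasure P] in
lemma eventually_integral_le (hY : HasPowerMGF P Y L) (l : EuclideanSpace ℝ (Fin d)) :
    ∃ C : ℝ, ∀ᶠ n : ℕ in atTop, ∫ ω, Real.exp (inner ℝ l (Y n ω)) ∂P ≤ C * (n : ℝ) ^ L l := by
  obtain ⟨c, -, hc⟩ := hY.tendsto l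
  refine ⟨c + 1, ?_⟩
  filter_upwards [hc.eventually_le_const (lt_add_one c), eventually_gt_atTop 0] with n hn hn0
  have hn' : (0 : ℝ) < n := by exact_mod_cast hn0
  rwa [Real.rpow_neg hn'.le, ← div_eq_mul_inv, div_le_iff₀ (Real.rpow_pos_of_pos hn' _)] at hn

omit [IsProbabilityMeasure P] in
lemma eventually_le_integral (hY : HasPowerMGF P Y L) (l : EuclideanSpace ℝ (Fin d)) :
    ∃ C : ℝ, 0 < C ∧
      ∀ᶠ n : ℕ in atTop, C * (n : ℝ) ^ L l ≤ ∫ ω, Real.exp (inner ℝ l (Y n ω)) ∂P := by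
  obtain ⟨c, hc0, hc⟩ := hY.tendsto l
  refine ⟨c / 2, half_pos hc0, ?_⟩
  filter_upwards [hc.eventually_const_le (half_lt_self hc0), eventually_gt_atTop 0] with n hn hn0
  have hn' : (0 : ℝ) < n := by exact_mod_cast hn0
  rwa [Real.rpow_neg hn'.le, ← div_eq_mul_inv, le_div_iff₀ (Real.rpow_pos_of_pos hn' _)] at hn

/-- Chernoff's bound: the event says `exp ⟨l, Y n⟩ > n ^ (a + L l)`, and the expectation is of order
`n ^ L l`. -/
lemma eventually_measure_halfspace_le (hY : HasPowerMGF P Y L) (l : EuclideanSpace ℝ (Fin d))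
    (a : ℝ) : ∃ C : ℝ, ∀ᶠ n : ℕ in atTop,
      P.real {ω | a < inner ℝ ((Real.log n)⁻¹ • Y n ω) l - L l} ≤ C * (n : ℝ) ^ (-a) := by
  obtain ⟨C, hC⟩ := hY.eventually_integral_le l
  refine ⟨C, ?_⟩
  filter_upwards [hC, eventually_ge_atTop 2] with n hn hn2
  have hn1 : (1 : ℝ) < n := by exact_mod_cast hn2
  have hn' : (0 : ℝ) < n := by linarith
  have hlog := Real.log_pos hn1
  have hpos := Real.rpow_pos_of_pos hn' (a + L l)
  have hsub : {ω | a < inner ℝ ((Real.log n)⁻¹ • Y n ω) l - L l}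
      ⊆ {ω | (n : ℝ) ^ (a + L l) ≤ Real.exp (inner ℝ l (Y n ω))} := by
    intro ω hω
    have h1 : a + L l < (Real.log n)⁻¹ * inner ℝ l (Y n ω) := by
      have : a < inner ℝ ((Real.log n)⁻¹ • Y n ω) l - L l := hω
      rw [inner_smul_left, conj_trivial, real_inner_comm] at this
      linarith
    have h2 : Real.log n * (a + L l) < inner ℝ l (Y n ω) := by
      rwa [inv_mul_eq_div, lt_div_iff₀' hlog] at h1
    change (n : ℝ) ^ (a + L l) ≤ Real.exp (inner ℝ l (Y n ω))
    rw [Real.rpow_def_of_pos hn']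
    exact Real.exp_le_exp.2 h2.le
  have hmarkov := mul_meas_ge_le_integral_of_nonneg
    (ae_of_all P fun ω => (Real.exp_pos (inner ℝ l (Y n ω))).le) (hY.integrable n l)
    ((n : ℝ) ^ (a + L l))
  have h3 : (n : ℝ) ^ (a + L l) * P.real {ω | a < inner ℝ ((Real.log n)⁻¹ • Y n ω) l - L l}
      ≤ C * (n : ℝ) ^ L l :=
    (mul_le_mul_of_nonneg_left (measureReal_mono hsub) hpos.le).trans (hmarkov.trans hn)
  rw [Real.rpow_neg hn'.le]
  rw [Real.rpow_add hn'] at h3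
  have h4 := Real.rpow_pos_of_pos hn' a
  have h5 := Real.rpow_pos_of_pos hn' (L l)
  rw [← div_eq_mul_inv, le_div_iff₀ h4]
  refine le_of_mul_le_mul_right ?_ h5
  linarith

/-- The upper bound of the Gärtner–Ellis theorem. -/
lemma eventually_measure_le (hY : HasPowerMGF P Y L) {F : Set (EuclideanSpace ℝ (Fin d))}
    (hF : IsClosed F) {a : ℝ} (h : ∀ x ∈ F, (a : EReal) < fenchelLegendre L x) :
    ∃ C : ℝ, ∀ᶠ n : ℕ in atTop,
      P.real {ω | (Real.log n)⁻¹ • Y n ω ∈ F} ≤ C * (n : ℝ) ^ (-a) := by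
  obtain ⟨T, hT⟩ := exists_finset_halfspace_cover hF h
  choose C hC using fun l => hY.eventually_measure_halfspace_le l a
  refine ⟨∑ l ∈ T, C l, ?_⟩
  filter_upwards [(Finset.eventually_all T).2 fun l _ => hC l] with n hn
  rw [Finset.sum_mul]
  refine le_trans ?_ (Finset.sum_le_sum hn)
  refine le_trans (measureReal_mono ?_ (measure_ne_top P _)) (measureReal_biUnion_finset_le T _)
  intro ω hω
  obtain ⟨l, hl, hlω⟩ := hT _ hω
  exact Set.mem_biUnion hl hlω

/-- The lower bound of the Gärtner–Ellis theorem near a point exposed by `l`, by exponential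
tilting. -/
lemma eventually_le_measure_of_exposed (hY : HasPowerMGF P Y L)
    {U : Set (EuclideanSpace ℝ (Fin d))} (hU : IsOpen U) {y l : EuclideanSpace ℝ (Fin d)}
    (hy : y ∈ U) (hD : ∀ h, HasDerivAt (fun t : ℝ => L (l + t • h)) (inner ℝ y h) 0)
    {η : ℝ} (hη : 0 < η) :
    ∃ C : ℝ, 0 < C ∧ ∀ᶠ n : ℕ in atTop,
      C * (n : ℝ) ^ (-(inner ℝ y l - L l) - η) ≤ P.real {ω | (Real.log n)⁻¹ • Y n ω ∈ U} := by
  -- The extra half-space keeps the tilting weight at most `n ^ (⟨y, l⟩ + η)` on the box.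
  obtain ⟨δ, hδ, hbox⟩ := exists_signedBasis_subset (y := y)
    (hU.inter (isOpen_lt (f := fun z => (inner ℝ z l : ℝ)) (g := fun _ => inner ℝ y l + η)
      (by fun_prop) continuous_const)) ⟨hy, by
        change (inner ℝ y l : ℝ) < inner ℝ y l + η; linarith⟩
  -- The slope of `L` at `l` along `h` is `⟨y, h⟩`, below `⟨y, h⟩ + δ`, so a small further tilt `t`
  -- makes the half-space beyond `⟨y, h⟩ + δ` negligible against `n ^ L l`.
  have htilt : ∀ h, ∃ t : ℝ, 0 < t ∧ L (l + t • h) - t * (inner ℝ y h + δ) < L l := by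
    intro h
    have h1 := (hD h).tendsto_slope_zero_right.eventually_lt_const
      (show (inner ℝ y h : ℝ) < inner ℝ y h + δ by linarith)
    obtain ⟨t, ht, ht0⟩ := (h1.and self_mem_nhdsWithin).exists
    have ht0' : 0 < t := ht0
    refine ⟨t, ht0', ?_⟩
    simp only [zero_add, zero_smul, add_zero, smul_eq_mul] at ht
    rw [inv_mul_lt_iff₀ ht0'] at ht
    linarith
  choose t ht0 ht using htilt
  obtain ⟨c, hc0, hc⟩ := hY.eventually_le_integral l
  choose C hC using fun h => hY.eventually_integral_le (l + t h • h)
  -- Together these terms stay below half of the total mass `c * n ^ L l`. The `+ 1` keeps the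
  -- denominator nonzero when `d = 0`.
  have hsmall : ∀ h, ∀ᶠ n : ℕ in atTop, C h * (n : ℝ) ^ (L (l + t h • h) - t h * (inner ℝ y h + δ))
      ≤ c / (2 * ((signedBasis d).card + 1)) * (n : ℝ) ^ L l :=
    fun h => eventually_mul_rpow_le _ (by positivity) (ht h)
  refine ⟨c / 2, half_pos hc0, ?_⟩
  filter_upwards [hc, (Finset.eventually_all (signedBasis d)).2 fun h _ => hC h,
    (Finset.eventually_all (signedBasis d)).2 fun h _ => hsmall h, eventually_ge_atTop 2]
    with n hcn hCn hsn hn2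
  have hn1 : (1 : ℝ) < n := by exact_mod_cast hn2
  have hn' : (0 : ℝ) < n := by linarith
  have hlog := Real.log_pos hn1
  set S : Set Ω := {ω | (Real.log n)⁻¹ • Y n ω ∈ U} with hS
  have hSm : MeasurableSet S := ((hY.measurable n).const_smul (Real.log n)⁻¹) hU.measurableSet
  -- Tilting without a change of measure: either the point lies in the box, where the weight is
  -- bounded, or some coordinate inequality fails and Chernoff's bound in that direction dominates
  -- the weight.
  have hpt : ∀ ω, Real.exp (inner ℝ l (Y n ω)) ≤
      S.indicator (fun _ => (n : ℝ) ^ (inner ℝ y l + η)) ω + ∑ h ∈ signedBasis d,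
        (n : ℝ) ^ (-(t h * (inner ℝ y h + δ))) * Real.exp (inner ℝ (l + t h • h) (Y n ω)) := by
    intro ω
    have hterm : ∀ h ∈ signedBasis d, 0 ≤ (n : ℝ) ^ (-(t h * (inner ℝ y h + δ))) *
        Real.exp (inner ℝ (l + t h • h) (Y n ω)) := fun h _ => by positivity
    by_cases hω : ∀ h ∈ signedBasis d,
        inner ℝ ((Real.log n)⁻¹ • Y n ω) h ≤ inner ℝ y h + δ
    · obtain ⟨h1, h2⟩ := hbox _ hω
      have h3 : (Real.log n)⁻¹ * inner ℝ l (Y n ω) < inner ℝ y l + η := by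
        have : (inner ℝ ((Real.log n)⁻¹ • Y n ω) l : ℝ) < inner ℝ y l + η := h2
        rwa [inner_smul_left, conj_trivial, real_inner_comm] at this
      rw [inv_mul_lt_iff₀ hlog] at h3
      rw [Set.indicator_of_mem (show ω ∈ S from h1), Real.rpow_def_of_pos hn']
      exact (Real.exp_le_exp.2 h3.le).trans
        (le_add_of_nonneg_right (Finset.sum_nonneg hterm))
    · push Not at hω
      obtain ⟨h, hh, hlt⟩ := hω
      refine le_trans ?_ (le_add_of_nonneg_left (Set.indicator_nonneg (fun _ _ => by positivity) ω))
      refine le_trans ?_ (Finset.single_le_sum hterm hh)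
      rw [inner_smul_left, conj_trivial, real_inner_comm h (Y n ω), lt_inv_mul_iff₀ hlog] at hlt
      rw [Real.rpow_def_of_pos hn', ← Real.exp_add, inner_add_left, inner_smul_left, conj_trivial]
      refine Real.exp_le_exp.2 ?_
      have := mul_le_mul_of_nonneg_left hlt.le (ht0 h).le
      linarith
  have hi1 : Integrable (S.indicator fun _ => (n : ℝ) ^ (inner ℝ y l + η)) P :=
    (integrable_const _).indicator hSm
  have hi2 : ∀ h ∈ signedBasis d, Integrable (fun ω => (n : ℝ) ^ (-(t h * (inner ℝ y h + δ))) *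
      Real.exp (inner ℝ (l + t h • h) (Y n ω))) P := fun h _ => (hY.integrable n _).const_mul _
  have hint := integral_mono (hY.integrable n l) (hi1.add (integrable_finsetSum _ hi2)) hpt
  simp only [Pi.add_apply] at hint
  rw [integral_add hi1 (integrable_finsetSum _ hi2), integral_finsetSum _ hi2,
    integral_indicator hSm, setIntegral_const, smul_eq_mul] at hint
  simp only [integral_const_mul] at hint
  have hsum : ∑ h ∈ signedBasis d, (n : ℝ) ^ (-(t h * (inner ℝ y h + δ))) *
      ∫ ω, Real.exp (inner ℝ (l + t h • h) (Y n ω)) ∂P ≤ c / 2 * (n : ℝ) ^ L l := by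
    calc _ ≤ ∑ h ∈ signedBasis d, c / (2 * ((signedBasis d).card + 1)) * (n : ℝ) ^ L l := by
          refine Finset.sum_le_sum fun h hh => le_trans ?_ (hsn h hh)
          rw [sub_eq_neg_add, Real.rpow_add hn']
          have := mul_le_mul_of_nonneg_left (hCn h hh)
            (Real.rpow_pos_of_pos hn' (-(t h * (inner ℝ y h + δ)))).le
          linarith
      _ = ((signedBasis d).card / ((signedBasis d).card + 1)) * (c / 2 * (n : ℝ) ^ L l) := by
          rw [Finset.sum_const, nsmul_eq_mul]
          field_simp
      _ ≤ c / 2 * (n : ℝ) ^ L l := by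
          refine mul_le_of_le_one_left (by positivity) ?_
          rw [div_le_one (by positivity)]
          linarith
  have hfin : c / 2 * (n : ℝ) ^ L l ≤ P.real S * (n : ℝ) ^ (inner ℝ y l + η) := by linarith
  have h4 := Real.rpow_pos_of_pos hn' (inner ℝ y l + η)
  have h5 : -(inner ℝ y l - L l) - η = L l - (inner ℝ y l + η) := by ring
  rw [h5, Real.rpow_sub hn', mul_div_assoc', div_le_iff₀ h4]
  exact hfin

/-- The lower bound of the Gärtner–Ellis theorem. -/
lemma eventually_le_measure (hY : HasPowerMGF P Y L) (hL : Differentiable ℝ L) (h0 : L 0 = 0)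
    (hlow : ∀ l, -1 ≤ L l) {G : Set (EuclideanSpace ℝ (Fin d))} (hG : IsOpen G)
    {x : EuclideanSpace ℝ (Fin d)} (hx : x ∈ G) {b : ℝ} (hb : fenchelLegendre L x ≤ (b : EReal))
    {η : ℝ} (hη : 0 < η) :
    ∃ C : ℝ, 0 < C ∧ ∀ᶠ n : ℕ in atTop,
      C * (n : ℝ) ^ (-b - η) ≤ P.real {ω | (Real.log n)⁻¹ • Y n ω ∈ G} := by
  obtain ⟨y, hy, l, hl, hD⟩ :=
    exists_exposed_near hL h0 hlow (fenchelLegendre_le_coe_iff.1 hb) hG hx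
  obtain ⟨C, hC0, hC⟩ := hY.eventually_le_measure_of_exposed hG hy hD hη
  refine ⟨C, hC0, ?_⟩
  filter_upwards [hC, eventually_ge_atTop 1] with n hn hn1
  refine le_trans (mul_le_mul_of_nonneg_left ?_ hC0.le) hn
  exact Real.rpow_le_rpow_of_exponent_le (by exact_mod_cast hn1) (by linarith)

end HasPowerMGF

variable {Z : ℕ → Ω → Fin d → ℤ}

lemma neg_iInf_interior_le_liminf (hY : HasPowerMGF P (fun n ω => colorVec (Z n ω)) L)
    (hL : Differentiable ℝ L) (h0 : L 0 = 0) (hlow : ∀ l, -1 ≤ L l)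
    (A : Set (EuclideanSpace ℝ (Fin d))) :
    -(⨅ x ∈ interior A, fenchelLegendre L x) ≤ liminf (scaledLogProb P Z A) atTop := by
  rw [EReal.neg_le]
  -- Only real `b` above the rate at `x` are tested, so points of infinite rate impose nothing.
  refine le_iInf₂ fun x hx => EReal.le_of_forall_lt_iff_le.1 fun b hb => ?_
  rw [EReal.neg_le]
  refine EReal.ge_of_forall_gt_iff_ge.1 fun z hz => ?_
  rw [← EReal.coe_neg, EReal.coe_lt_coe_iff] at hz
  -- Half of the gap between `z` and `-b` is spent on `η`; the other half absorbs the constant `C`.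
  obtain ⟨C, hC0, hC⟩ := hY.eventually_le_measure hL h0 hlow isOpen_interior hx hb.le
    (η := (-b - z) / 2) (by linarith)
  refine le_liminf_of_le (by isBoundedDefault) ?_
  filter_upwards [hC, eventually_mul_rpow_le (a := z) (b := -b - (-b - z) / 2) 1 hC0 (by linarith),
    eventually_ge_atTop 2] with n hn hn' hn2
  refine coe_le_scaledLogProb hn2 ?_
  rw [one_mul] at hn'
  exact hn'.trans (hn.trans (measureReal_mono fun ω hω => interior_subset (s := A) hω))

lemma limsup_le_neg_iInf_closure (hY : HasPowerMGF P (fun n ω => colorVec (Z n ω)) L)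
    (A : Set (EuclideanSpace ℝ (Fin d))) :
    limsup (scaledLogProb P Z A) atTop ≤ -(⨅ x ∈ closure A, fenchelLegendre L x) := by
  refine EReal.le_of_forall_lt_iff_le.1 fun z hz => ?_
  rw [EReal.neg_lt_comm, ← EReal.coe_neg] at hz
  -- A real `a` strictly between `-z` and the infimum leaves room in the exponent to absorb the
  -- constant.
  obtain ⟨a, hza, ha⟩ := EReal.lt_iff_exists_real_btwn.1 hz
  rw [EReal.coe_lt_coe_iff] at hza
  obtain ⟨C, hC⟩ := hY.eventually_measure_le isClosed_closure (a := a)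
    fun x hx => ha.trans_le (iInf₂_le x hx)
  refine limsup_le_of_le (by isBoundedDefault) ?_
  filter_upwards [hC, eventually_mul_rpow_le (a := -a) (b := z) C one_pos (by linarith),
    eventually_ge_atTop 2] with n hn hn' hn2
  refine scaledLogProb_le_coe hn2 ?_
  rw [one_mul] at hn'
  refine le_trans (measureReal_mono (fun ω hω => ?_) (measure_ne_top P _)) (hn.trans hn')
  exact subset_closure (s := A) hω

end largeDeviations

theorem theorem3p1 {d : ℕ} {Ω : Type*} [MeasurableSpace Ω] (P : Measure Ω)
    [IsProbabilityMeasure P] (p U₀ : PMF (Fin d → ℤ)) (hp : p.support.Finite)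
    (hU₀ : U₀.support.Finite) (Z : ℕ → Ω → Fin d → ℤ) (hZ : IsUrnColorProcess P p U₀ Z) :
    (∀ A : Set (EuclideanSpace ℝ (Fin d)),
      -(⨅ x ∈ interior A, urnRate p x) ≤ liminf (scaledLogProb P Z A) atTop ∧
      liminf (scaledLogProb P Z A) atTop ≤ limsup (scaledLogProb P Z A) atTop ∧
      limsup (scaledLogProb P Z A) atTop ≤ -(⨅ x ∈ closure A, urnRate p x)) ∧
    IsConvexEReal (urnRate p) ∧ IsGoodRateFunction (urnRate p) := by
  have h0 : incrementMGF p 0 - 1 = 0 := by rw [incrementMGF_zero, sub_self]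
  have hY : HasPowerMGF P (fun n ω => colorVec (Z n ω)) fun l => incrementMGF p l - 1 :=
    { measurable := fun n => (Measurable.of_discrete (f := colorVec)).comp (hZ.measurable_color n)
      integrable := integrable_exp_inner_color hp hU₀ hZ
      tendsto := tendsto_integral_exp_inner_color hp hU₀ hZ }
  refine ⟨fun A => ⟨?_, liminf_le_limsup, limsup_le_neg_iInf_closure hY A⟩,
    isConvexEReal_fenchelLegendre _, isGoodRateFunction_fenchelLegendre h0⟩
  exact neg_iInf_interior_le_liminf hY ((differentiable_incrementMGF hp).sub_const 1) h0
    (fun l => by linarith [incrementMGF_pos hp l]) A
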